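/- Let $C$ be a normal cone with nonempty interior $\operatorname{int} C$ in a real Banach space $(X,\|\cdot\|)$, that is, $C$ is a closed convex cone with vertex $0$ such that $C\cap(-C)=\{0\}$ and, for the order $x\le y \iff y-x\in C$, there is a constant $M$ with $\|x\|\le M\|y\|$ whenever $0\le x\le y$. Let $\psi\neq 0$ be a continuous linear form on $X$ that is nonnegative on $C$, and let $\Sigma=\{x\in\operatorname{int} C : \psi(x)=1\}$. Hilbert's projective metric is $$d(x,y)=\log \inf\{b\in\mathbb{R} : y\le bx\}-\log\sup\{a\in\mathbb{R} : ax\le y\},\qquad x,y\in\operatorname{int} C.$$ For a bounded linear operator $L:X\to X$, let $r(L)=\lim_{k\to\infty}\|L^k\|^{1/k}=\inf_{k\ge1}\|L^k\|^{1/k}$ be its spectral radius. The operator $L$ satisfies the weak Krein–Rutman condition with respect to $C$ if $L(C)\subset C$ and either $r(L)=0$, or $r:=r(L)>0$ and (i) there is $u\in C\setminus\{0\}$ such that the null space of $r\,\mathrm{Id}-L$ is $\{\lambda u:\lambda\in\mathbb{R}\}$, and (ii) $r\,\mathrm{Id}-L$ is semi-Fredholm (its range is closed, and its kernel is finite dimensional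 or its range has finite codimension). Let $G$ be an open subset of $X$ included in $C$, and let $f:G\to\operatorname{int} C$ be a map such that $d(f(x),f(y))\le d(x,y)$ for all $x,y\in G\cap\Sigma$. Let $v\in G\cap\Sigma$ satisfy $f(v)=v$. Assume that: 1. $f$ is (Fréchet) differentiable at $v$, with derivative $f'_v$; 2. $f'_v$ satisfies the weak Krein–Rutman condition with respect to $C$; 3. if $r(f'_v)>0$ and $u\in C\setminus\{0\}$ satisfies $f'_v(u)=r(f'_v)\,u$, then $\psi(u)>0$; 4. there exists $\delta$ with $0<\delta\le1$ such that $tv\in G$ and $t f(v)\le f(tv)$ for all $t$ with $1-\delta\le t\le1$. Then $v$ is the unique eigenvector of $f$ in $G\cap\Sigma$: for $w\in G\cap\Sigma$, there exists $\lambda>0$ with $f(w)=\lambda w$ if and only if $w=v$. -/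

import Mathlib

noncomputable section

namespace ConeMap

variable {X : Type*} [NormedAddCommGroup X] [NormedSpace ℝ X]

/-- The relation `x ≤ y` induced by the cone `C`: `y - x ∈ C`. -/
def Le (C : ProperCone ℝ X) (x y : X) : Prop := y - x ∈ C

/-- A normal cone. Mathlib's `ProperCone` is a closed convex cone with vertex `0` (containing `0`);
we add that `C ∩ (-C) = {0}`, and that the norm is monotone on `C` up to a constant. -/
structure IsNormalCone (C : ProperCone ℝ X) : Prop where
  pointed : ∀ x ∈ C, -x ∈ C → x = 0
  normal : ∃ M : ℝ, ∀ x y : X, Le C 0 x → Le C x y → ‖x‖ ≤ M * ‖y‖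

/-- Membership in `C* \ {0}`: a nonzero continuous linear form, nonnegative on `C`. -/
def IsNonzeroDual (C : ProperCone ℝ X) (ψ : X →L[ℝ] ℝ) : Prop :=
  ψ ≠ 0 ∧ ∀ x ∈ C, 0 ≤ ψ x

/-- The slice `Σ = {x ∈ int C | ψ x = 1}`. -/
def slice (C : ProperCone ℝ X) (ψ : X →L[ℝ] ℝ) : Set X :=
  {x | x ∈ interior (C : Set X) ∧ ψ x = 1}

/-- `M(y/x) = inf {b | y ≤ b x}`. It is only used for comparable `x, y ∈ C \ {0}` (for instance
for `x, y ∈ int C`), where the set is nonempty and bounded below. -/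
def upperRatio (C : ProperCone ℝ X) (y x : X) : ℝ := sInf {b : ℝ | Le C y (b • x)}

/-- `m(y/x) = sup {a | a x ≤ y}`. It is only used for comparable `x, y ∈ C \ {0}`, where the set
is nonempty and bounded above. -/
def lowerRatio (C : ProperCone ℝ X) (y x : X) : ℝ := sSup {a : ℝ | Le C (a • x) y}

/-- Hilbert's projective metric `d(x, y) = log M(y/x) - log m(y/x)`, for comparable `x, y`. -/
def hilbertDist (C : ProperCone ℝ X) (x y : X) : ℝ :=
  Real.log (upperRatio C y x) - Real.log (lowerRatio C y x)

/-- The spectral radius `r(L) = inf_{k ≥ 1} ‖L ^ k‖ ^ (1 / k) = lim_k ‖L ^ k‖ ^ (1 / k)` of a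
bounded operator on a real Banach space (not the supremum over the real spectrum only). -/
def specRadius (L : X →L[ℝ] X) : ℝ :=
  ⨅ k : ℕ, ‖L ^ (k + 1)‖ ^ (1 / ((k : ℝ) + 1))

/-- Semi-Fredholm operators: the range is closed, and the kernel is finite dimensional or the range
has finite codimension. -/
def IsSemiFredholm (T : X →L[ℝ] X) : Prop :=
  IsClosed (Set.range T) ∧
    (FiniteDimensional ℝ (LinearMap.ker (T : X →ₗ[ℝ] X)) ∨
      FiniteDimensional ℝ (X ⧸ LinearMap.range (T : X →ₗ[ℝ] X)))

/-- The weak Krein-Rutman condition with respect to `C`. -/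
def WeakKreinRutman (C : ProperCone ℝ X) (L : X →L[ℝ] X) : Prop :=
  (∀ x ∈ C, L x ∈ C) ∧
    (specRadius L = 0 ∨
      (0 < specRadius L ∧
        (∃ u ∈ C, u ≠ 0 ∧
          {x : X | (specRadius L • ContinuousLinearMap.id ℝ X - L) x = 0} =
            {x : X | ∃ c : ℝ, x = c • u}) ∧
        IsSemiFredholm (specRadius L • ContinuousLinearMap.id ℝ X - L)))

end ConeMap

end

/-!
Let `L` be the derivative of `f` at `v`, and let `T` be that of the normalised map `g = f / ψ(f)`,
a self-map of the hyperplane `ψ = 1`. Subhomogeneity differentiates to `L v ≤ v`, and comparison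
with `v` then gives `r(L) ≤ 1` and makes `1 - T` injective on `ker ψ`. Since `1 - T` is a rank one
perturbation of `1 - L`, its range stays closed, so it is bounded below on `ker ψ`.

Suppose `w ≠ v` were a second eigenvector. The points of the slice lying metrically between `v` and
`w`, at Hilbert distance `log (1 + s)` from `v`, form a nonempty convex set (the lens), which `g`
maps into itself because `f` is nonexpansive and fixes both rays. Averages of a `g`-orbit in the
lens are almost fixed by the linearisation of `g` at `v`, hence are `o(s)`-close to `v` as `s → 0`;
but every point of the lens is at norm distance at least a constant times `s` from `v`.
-/

open Filter Topology

namespace ConeMap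

open scoped Pointwise

variable {X : Type*} [NormedAddCommGroup X] [NormedSpace ℝ X] {C : ProperCone ℝ X}

section Order

theorem le_of_sub_eq {x y x' y' : X} (h : Le C x y) (heq : y' - x' = y - x) : Le C x' y' := by
  rwa [Le, heq]

theorem Le.trans {x y z : X} (h₁ : Le C x y) (h₂ : Le C y z) : Le C x z := by
  have h := C.add_mem h₁ h₂
  rwa [sub_add_sub_cancel'] at h

theorem Le.add {x y x' y' : X} (h : Le C x y) (h' : Le C x' y') : Le C (x + x') (y + y') := by
  have hadd := C.add_mem h h'
  rwa [sub_add_sub_comm] at hadd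

theorem Le.smul {x y : X} (h : Le C x y) {c : ℝ} (hc : 0 ≤ c) : Le C (c • x) (c • y) := by
  simpa only [Le, smul_sub] using C.smul_mem h hc

theorem smul_le_smul_of_mem {x : X} (hx : x ∈ C) {a b : ℝ} (hab : a ≤ b) :
    Le C (a • x) (b • x) := by
  simpa only [Le, sub_smul] using C.smul_mem hx (sub_nonneg.2 hab)

theorem smul_le_iff_le_inv_smul {a : ℝ} (ha : 0 < a) {x y : X} :
    Le C (a • x) y ↔ Le C x (a⁻¹ • y) :=
  ⟨fun h => by simpa only [inv_smul_smul₀ ha.ne'] using h.smul (inv_nonneg.2 ha.le),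
    fun h => by simpa only [smul_inv_smul₀ ha.ne'] using h.smul ha.le⟩

theorem le_smul_iff_inv_smul_le {a : ℝ} (ha : 0 < a) {x y : X} :
    Le C x (a • y) ↔ Le C (a⁻¹ • x) y := by
  rw [smul_le_iff_le_inv_smul (inv_pos.2 ha), inv_inv]

theorem Le.apply {x y : X} (h : Le C x y) {ψ : X →L[ℝ] ℝ} (hψ : ∀ z ∈ C, 0 ≤ ψ z) :
    ψ x ≤ ψ y := by
  simpa only [map_sub, sub_nonneg] using hψ _ h

theorem Le.map {x y : X} (h : Le C x y) {L : X →L[ℝ] X} (hL : ∀ z ∈ C, L z ∈ C) :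
    Le C (L x) (L y) := by
  simpa only [Le, map_sub] using hL _ h

theorem exists_le_norm_smul {v : X} (hv : v ∈ interior (C : Set X)) :
    ∃ K : ℝ, 0 < K ∧ ∀ x : X, Le C (-(K * ‖x‖) • v) x ∧ Le C x ((K * ‖x‖) • v) := by
  obtain ⟨ε, hε, hball⟩ := Metric.isOpen_iff.1 isOpen_interior v hv
  have upper (x : X) : Le C x ((2 / ε * ‖x‖) • v) := by
    rcases eq_or_ne x 0 with rfl | hx
    · simp [Le]
    have : 0 < ‖x‖ := norm_pos_iff.2 hx
    rw [le_smul_iff_inv_smul_le (by positivity)]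
    refine interior_subset (hball ?_)
    rw [Metric.mem_ball, dist_eq_norm, sub_sub_cancel_left, norm_neg, norm_smul,
      Real.norm_of_nonneg (by positivity)]
    field_simp
    norm_num
  refine ⟨2 / ε, by positivity, fun x => ⟨le_of_sub_eq (upper (-x)) ?_, upper x⟩⟩
  rw [norm_neg]
  module

theorem apply_pos_of_mem_interior {ψ : X →L[ℝ] ℝ} (hψ : IsNonzeroDual C ψ) {v : X}
    (hv : v ∈ interior (C : Set X)) : 0 < ψ v := by
  obtain ⟨K, -, hK⟩ := exists_le_norm_smul hv
  refine (hψ.2 v (interior_subset hv)).lt_of_ne fun h0 => hψ.1 ?_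
  ext x
  have hlower := (hK x).1.apply hψ.2
  have hupper := (hK x).2.apply hψ.2
  simp only [map_smul, smul_eq_mul, ← h0, mul_zero] at hlower hupper
  exact le_antisymm hupper hlower

theorem IsNormalCone.exists_norm_le_of_mem_orderInterval (hC : IsNormalCone C) (v : X) :
    ∃ K : ℝ, 0 < K ∧ ∀ (x : X) (t : ℝ), 0 ≤ t → Le C (-t • v) x → Le C x (t • v) →
      ‖x‖ ≤ K * t := by
  obtain ⟨M, hM⟩ := hC.normal
  refine ⟨(2 * |M| + 1) * ‖v‖ + 1, by positivity, fun x t ht hlower hupper => ?_⟩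
  have hshift : ‖x + t • v‖ ≤ |M| * (2 * t * ‖v‖) := by
    have h := hM (x + t • v) ((2 * t) • v) (le_of_sub_eq hlower (by module))
      (le_of_sub_eq hupper (by module))
    rw [norm_smul, Real.norm_of_nonneg (by positivity)] at h
    exact h.trans (by gcongr; exact le_abs_self M)
  have htri : ‖x‖ ≤ ‖x + t • v‖ + t * ‖v‖ := by
    have := norm_sub_le (x + t • v) (t • v)
    rwa [add_sub_cancel_right, norm_smul, Real.norm_of_nonneg ht] at this
  linarith

theorem smul_mem_interior {c : ℝ} (hc : 0 < c) {x : X} (hx : x ∈ interior (C : Set X)) :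
    c • x ∈ interior (C : Set X) := by
  have hmaps : c • (C : Set X) ⊆ C := by
    rintro _ ⟨y, hy, rfl⟩
    exact C.smul_mem hy hc.le
  refine interior_mono hmaps ?_
  rw [interior_smul₀ hc.ne']
  exact Set.smul_mem_smul_set hx

theorem add_mem_interior {x y : X} (hx : x ∈ interior (C : Set X)) (hy : y ∈ C) :
    x + y ∈ interior (C : Set X) := by
  have hadd : (C : Set X) + C ⊆ C := Set.add_subset_iff.2 fun _ ha _ hb => C.add_mem ha hb
  exact interior_mono hadd (subset_interior_add_left (Set.add_mem_add hx hy))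

theorem inv_apply_smul_mem_slice {ψ : X →L[ℝ] ℝ} (hψ : IsNonzeroDual C ψ) {x : X}
    (hx : x ∈ interior (C : Set X)) : (ψ x)⁻¹ • x ∈ slice C ψ := by
  have hpos := apply_pos_of_mem_interior hψ hx
  refine ⟨smul_mem_interior (inv_pos.2 hpos) hx, ?_⟩
  rw [map_smul, smul_eq_mul, inv_mul_cancel₀ hpos.ne']

theorem convex_slice (C : ProperCone ℝ X) (ψ : X →L[ℝ] ℝ) : Convex ℝ (slice C ψ) :=
  C.convex.interior.inter (convex_hyperplane (ψ : X →ₗ[ℝ] ℝ).isLinear 1)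

end Order

section Ratio

variable {ψ : X →L[ℝ] ℝ} {x y : X}

theorem bddBelow_setOf_le_smul (hψ : IsNonzeroDual C ψ) (hx : x ∈ interior (C : Set X)) :
    BddBelow {b : ℝ | Le C y (b • x)} := by
  refine ⟨ψ y / ψ x, fun b hb => (div_le_iff₀ (apply_pos_of_mem_interior hψ hx)).2 ?_⟩
  simpa only [map_smul, smul_eq_mul] using Le.apply hb hψ.2

theorem bddAbove_setOf_smul_le (hψ : IsNonzeroDual C ψ) (hx : x ∈ interior (C : Set X)) :
    BddAbove {a : ℝ | Le C (a • x) y} := by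
  refine ⟨ψ y / ψ x, fun a ha => (le_div_iff₀ (apply_pos_of_mem_interior hψ hx)).2 ?_⟩
  simpa only [map_smul, smul_eq_mul] using Le.apply ha hψ.2

theorem le_upperRatio_smul (hψ : IsNonzeroDual C ψ) (hx : x ∈ interior (C : Set X)) :
    Le C y (upperRatio C y x • x) := by
  have hclosed : IsClosed {b : ℝ | Le C y (b • x)} :=
    C.isClosed.preimage (f := fun b : ℝ => b • x - y) (by fun_prop)
  obtain ⟨K, -, hK⟩ := exists_le_norm_smul hx
  exact hclosed.csInf_mem ⟨_, (hK y).2⟩ (bddBelow_setOf_le_smul hψ hx)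

theorem lowerRatio_smul_le (hψ : IsNonzeroDual C ψ) (hx : x ∈ interior (C : Set X)) :
    Le C (lowerRatio C y x • x) y := by
  have hclosed : IsClosed {a : ℝ | Le C (a • x) y} :=
    C.isClosed.preimage (f := fun a : ℝ => y - a • x) (by fun_prop)
  obtain ⟨K, -, hK⟩ := exists_le_norm_smul hx
  exact hclosed.csSup_mem ⟨_, (hK y).1⟩ (bddAbove_setOf_smul_le hψ hx)

theorem upperRatio_le_iff (hψ : IsNonzeroDual C ψ) (hx : x ∈ interior (C : Set X)) {b : ℝ} :
    upperRatio C y x ≤ b ↔ Le C y (b • x) :=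
  ⟨fun h => (le_upperRatio_smul hψ hx).trans (smul_le_smul_of_mem (interior_subset hx) h),
    fun h => csInf_le (bddBelow_setOf_le_smul hψ hx) h⟩

theorem le_lowerRatio_iff (hψ : IsNonzeroDual C ψ) (hx : x ∈ interior (C : Set X)) {a : ℝ} :
    a ≤ lowerRatio C y x ↔ Le C (a • x) y :=
  ⟨fun h => (smul_le_smul_of_mem (interior_subset hx) h).trans (lowerRatio_smul_le hψ hx),
    fun h => le_csSup (bddAbove_setOf_smul_le hψ hx) h⟩

theorem lowerRatio_le_upperRatio (hψ : IsNonzeroDual C ψ) (hx : x ∈ interior (C : Set X)) :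
    lowerRatio C y x ≤ upperRatio C y x := by
  have h := ((lowerRatio_smul_le (y := y) hψ hx).trans (le_upperRatio_smul hψ hx)).apply hψ.2
  simp only [map_smul, smul_eq_mul] at h
  exact le_of_mul_le_mul_right h (apply_pos_of_mem_interior hψ hx)

theorem lowerRatio_pos (hψ : IsNonzeroDual C ψ) (hx : x ∈ interior (C : Set X))
    (hy : y ∈ interior (C : Set X)) : 0 < lowerRatio C y x := by
  obtain ⟨K, hK, horder⟩ := exists_le_norm_smul hy
  have hx0 : 0 < ‖x‖ := norm_pos_iff.2 fun h0 => by
    simpa [h0] using apply_pos_of_mem_interior hψ hx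
  have hlower : Le C ((K * ‖x‖)⁻¹ • x) y :=
    (le_smul_iff_inv_smul_le (by positivity)).1 (horder x).2
  exact lt_of_lt_of_le (by positivity) ((le_lowerRatio_iff hψ hx).2 hlower)

theorem upperRatio_pos (hψ : IsNonzeroDual C ψ) (hx : x ∈ interior (C : Set X))
    (hy : 0 < ψ y) : 0 < upperRatio C y x := by
  have h := hy.trans_le ((le_upperRatio_smul (y := y) hψ hx).apply hψ.2)
  rw [map_smul, smul_eq_mul] at h
  exact pos_of_mul_pos_left h (apply_pos_of_mem_interior hψ hx).le

theorem eq_of_upperRatio_le_lowerRatio (hC : IsNormalCone C) (hψ : IsNonzeroDual C ψ)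
    (hx : x ∈ slice C ψ) (hy : y ∈ slice C ψ) (h : upperRatio C y x ≤ lowerRatio C y x) :
    y = x := by
  set c := lowerRatio C y x
  have hlower : Le C (c • x) y := lowerRatio_smul_le hψ hx.1
  have hupper : Le C y (c • x) := (upperRatio_le_iff hψ hx.1).1 h
  have heq : y = c • x :=
    sub_eq_zero.1 (hC.pointed _ hlower (by rw [neg_sub]; exact hupper))
  have hc : c = 1 := by simpa [hx.2, hy.2] using (congrArg ψ heq).symm
  rw [heq, hc, one_smul]

end Ratio

section HilbertBall

variable {ψ : X →L[ℝ] ℝ} {x y : X} {ρ : ℝ}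

/-- The closed ball of radius `log ρ` about `x` for Hilbert's metric, as a cone in `X`: no
normalisation is imposed on `y`. Stating the condition by order inequalities avoids logarithms and
makes convexity visible. -/
def ratioBall (C : ProperCone ℝ X) (x : X) (ρ : ℝ) : Set X :=
  {y | ∃ a : ℝ, 0 < a ∧ Le C (a • x) y ∧ Le C y ((ρ * a) • x)}

theorem convex_ratioBall (C : ProperCone ℝ X) (x : X) (ρ : ℝ) : Convex ℝ (ratioBall C x ρ) := by
  rw [convex_iff_forall_pos]
  rintro y ⟨a, ha, hay, hya⟩ z ⟨b, hb, hbz, hzb⟩ s t hs ht -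
  refine ⟨s * a + t * b, by positivity, ?_, ?_⟩
  · exact le_of_sub_eq ((hay.smul hs.le).add (hbz.smul ht.le)) (by module)
  · exact le_of_sub_eq ((hya.smul hs.le).add (hzb.smul ht.le)) (by module)

theorem smul_mem_ratioBall (hy : y ∈ ratioBall C x ρ) {c : ℝ} (hc : 0 < c) :
    c • y ∈ ratioBall C x ρ := by
  obtain ⟨a, ha, hlower, hupper⟩ := hy
  exact ⟨c * a, by positivity, le_of_sub_eq (hlower.smul hc.le) (by module),
    le_of_sub_eq (hupper.smul hc.le) (by module)⟩

theorem mem_ratioBall_of_mem_smul {c : ℝ} (hc : 0 < c) (hy : y ∈ ratioBall C (c • x) ρ) :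
    y ∈ ratioBall C x ρ := by
  obtain ⟨a, ha, hlower, hupper⟩ := hy
  refine ⟨a * c, by positivity, ?_, ?_⟩
  · rwa [mul_smul]
  · rwa [← mul_assoc, mul_smul]

theorem hilbertDist_le_log_iff (hψ : IsNonzeroDual C ψ) (hx : x ∈ interior (C : Set X))
    (hy : y ∈ interior (C : Set X)) (hρ : 0 < ρ) :
    hilbertDist C x y ≤ Real.log ρ ↔ y ∈ ratioBall C x ρ := by
  have hm := lowerRatio_pos hψ hx hy
  have hM := hm.trans_le (lowerRatio_le_upperRatio hψ hx)
  rw [hilbertDist, sub_le_iff_le_add, ← Real.log_mul hρ.ne' hm.ne',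
    Real.log_le_log_iff hM (by positivity)]
  constructor
  · exact fun h => ⟨_, hm, lowerRatio_smul_le hψ hx, (upperRatio_le_iff hψ hx).1 h⟩
  · rintro ⟨a, -, hlower, hupper⟩
    calc upperRatio C y x ≤ ρ * a := (upperRatio_le_iff hψ hx).2 hupper
      _ ≤ ρ * lowerRatio C y x := by gcongr; exact (le_lowerRatio_iff hψ hx).2 hlower

/-- The map induced by `f` on the hyperplane `ψ = 1`. -/
noncomputable def normalizedMap (ψ : X →L[ℝ] ℝ) (f : X → X) (x : X) : X := (ψ (f x))⁻¹ • f x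

theorem normalizedMap_mem_ratioBall (hψ : IsNonzeroDual C ψ) {f : X → X}
    (hx : x ∈ interior (C : Set X)) (hy : y ∈ interior (C : Set X))
    (hfy : f y ∈ interior (C : Set X)) (hρ : 0 < ρ)
    (hnonexp : hilbertDist C (f x) (f y) ≤ hilbertDist C x y) {c : ℝ} (hc : 0 < c)
    (hfx : f x = c • x) (hmem : y ∈ ratioBall C x ρ) :
    normalizedMap ψ f y ∈ ratioBall C x ρ := by
  have hdist : hilbertDist C (c • x) (f y) ≤ Real.log ρ :=
    hfx ▸ hnonexp.trans ((hilbertDist_le_log_iff hψ hx hy hρ).2 hmem)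
  have hball := (hilbertDist_le_log_iff hψ (smul_mem_interior hc hx) hfy hρ).1 hdist
  exact smul_mem_ratioBall (mem_ratioBall_of_mem_smul hc hball)
    (inv_pos.2 (apply_pos_of_mem_interior hψ hfy))

end HilbertBall

section HilbertLens

variable {ψ : X →L[ℝ] ℝ} {v w : X}

/-- The points `y` of the slice metrically between `v` and `w`, at distance `log ρ` from `v`:
`d(v, y) ≤ log ρ` and `d(w, y) ≤ d(v, w) - log ρ`. -/
def hilbertLens (C : ProperCone ℝ X) (ψ : X →L[ℝ] ℝ) (v w : X) (ρ : ℝ) : Set X :=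
  slice C ψ ∩ ratioBall C v ρ ∩ ratioBall C w (upperRatio C w v / lowerRatio C w v / ρ)

theorem convex_hilbertLens (C : ProperCone ℝ X) (ψ : X →L[ℝ] ℝ) (v w : X) (ρ : ℝ) :
    Convex ℝ (hilbertLens C ψ v w ρ) :=
  ((convex_slice C ψ).inter (convex_ratioBall C v ρ)).inter (convex_ratioBall C w _)

/-- With `a v ≤ w ≤ b v`, the lens meets the segment from `v` to `w` at the direction
`(b - ρ a) v + (ρ - 1) w`: straight segments are geodesics. -/
theorem hilbertLens_nonempty (hψ : IsNonzeroDual C ψ) (hv : v ∈ slice C ψ) (hw : w ∈ slice C ψ)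
    {ρ : ℝ} (hρ : 1 ≤ ρ) (hlt : ρ * lowerRatio C w v < upperRatio C w v) :
    (hilbertLens C ψ v w ρ).Nonempty := by
  have ha := lowerRatio_pos hψ hv.1 hw.1
  have hlower : Le C (lowerRatio C w v • v) w := lowerRatio_smul_le hψ hv.1
  have hupper : Le C w (upperRatio C w v • v) := le_upperRatio_smul hψ hv.1
  set a := lowerRatio C w v
  set b := upperRatio C w v
  have hab : a < b := (le_mul_of_one_le_left ha.le hρ).trans_lt hlt
  have hb : 0 < b := ha.trans hab
  have hba : 0 < b - a := sub_pos.2 hab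
  have hρa : 0 < b - ρ * a := sub_pos.2 hlt
  have : 0 < ρ := by linarith
  set y := (b - ρ * a) • v + (ρ - 1) • w
  have hy : y ∈ interior (C : Set X) :=
    add_mem_interior (smul_mem_interior hρa hv.1)
      (C.smul_mem (interior_subset hw.1) (sub_nonneg.2 hρ))
  have hyv : y ∈ ratioBall C v ρ := by
    refine ⟨b - a, hba, ?_, ?_⟩
    · exact le_of_sub_eq (hlower.smul (sub_nonneg.2 hρ)) (by module)
    · exact le_of_sub_eq (hupper.smul (sub_nonneg.2 hρ)) (by module)
  have hyw : y ∈ ratioBall C w (b / a / ρ) := by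
    refine ⟨ρ * (b - a) / b, by positivity, ?_, ?_⟩
    · refine le_of_sub_eq (hupper.smul (c := (b - ρ * a) / b) (by positivity)) ?_
      simp only [y]
      match_scalars <;> field_simp
      ring
    · refine le_of_sub_eq (hlower.smul (c := (b - ρ * a) / a) (by positivity)) ?_
      simp only [y]
      match_scalars <;> field_simp
      ring
  have hψy := inv_pos.2 (apply_pos_of_mem_interior hψ hy)
  exact ⟨(ψ y)⁻¹ • y, ⟨inv_apply_smul_mem_slice hψ hy, smul_mem_ratioBall hyv hψy⟩,
    smul_mem_ratioBall hyw hψy⟩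

theorem exists_norm_sub_le_of_mem_ratioBall (hC : IsNormalCone C) (hψ : IsNonzeroDual C ψ)
    (hv : v ∈ slice C ψ) :
    ∃ K : ℝ, 0 < K ∧ ∀ (y : X) (ρ : ℝ), ψ y = 1 → 1 ≤ ρ → y ∈ ratioBall C v ρ →
      ‖y - v‖ ≤ K * (ρ - 1) := by
  obtain ⟨K, hK, hnorm⟩ := hC.exists_norm_le_of_mem_orderInterval v
  refine ⟨K, hK, fun y ρ hy hρ ⟨c, _, hlower, hupper⟩ => ?_⟩
  have hc1 : c ≤ 1 := by simpa [hv.2, hy] using hlower.apply hψ.2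
  have hρc : 1 ≤ ρ * c := by simpa [hv.2, hy] using hupper.apply hψ.2
  have hvC := interior_subset hv.1
  refine hnorm _ _ (sub_nonneg.2 hρ) ?_ ?_
  · exact le_of_sub_eq ((smul_le_smul_of_mem hvC (show 2 - ρ ≤ c by nlinarith)).trans hlower)
      (by module)
  · exact le_of_sub_eq (hupper.trans (smul_le_smul_of_mem hvC (show ρ * c ≤ ρ by nlinarith)))
      (by module)

/-- A point of the lens cannot be closer to `v` than `log ρ`, by the triangle inequality. -/
theorem exists_sub_one_le_of_mem_hilbertLens (hψ : IsNonzeroDual C ψ) (hv : v ∈ slice C ψ)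
    (hw : w ∈ slice C ψ) :
    ∃ K : ℝ, 0 < K ∧ ∀ (y : X) (ρ : ℝ), 0 < ρ → y ∈ hilbertLens C ψ v w ρ →
      ρ - 1 ≤ K * ‖y - v‖ * (ρ + 1) := by
  obtain ⟨K, hK, horder⟩ := exists_le_norm_smul hv.1
  refine ⟨K, hK, fun y ρ hρ ⟨_, c, hc, hlower, hupper⟩ => ?_⟩
  have ha := lowerRatio_pos hψ hv.1 hw.1
  have hb := ha.trans_le (lowerRatio_le_upperRatio hψ hv.1)
  have hnear := horder (y - v)
  set κ := K * ‖y - v‖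
  have hvy : Le C ((1 - κ) • v) y := le_of_sub_eq hnear.1 (by module)
  have hyv : Le C y ((1 + κ) • v) := le_of_sub_eq hnear.2 (by module)
  have hbc : upperRatio C w v * c ≤ 1 + κ := by
    rw [← le_div_iff₀ hc, upperRatio_le_iff hψ hv.1, div_eq_inv_mul, mul_smul]
    exact (smul_le_iff_le_inv_smul hc).1 (hlower.trans hyv)
  have hac : (1 - κ) * ρ ≤ upperRatio C w v * c := by
    have hσ : 0 < upperRatio C w v / lowerRatio C w v / ρ * c := by positivity
    have h : Le C (((upperRatio C w v / lowerRatio C w v / ρ * c)⁻¹ * (1 - κ)) • v) w := by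
      rw [mul_smul]
      exact (le_smul_iff_inv_smul_le hσ).1 (hvy.trans hupper)
    have h' := (le_lowerRatio_iff hψ hv.1).2 h
    rw [inv_mul_le_iff₀ hσ] at h'
    field_simp at h'
    linarith
  linarith

theorem mapsTo_normalizedMap_hilbertLens (hψ : IsNonzeroDual C ψ) {f : X → X}
    (hv : v ∈ slice C ψ) (hw : w ∈ slice C ψ) {ρ : ℝ} (hρ : 0 < ρ)
    (hf : Set.MapsTo f (hilbertLens C ψ v w ρ) (interior (C : Set X)))
    (hnonexp : ∀ z ∈ ({v, w} : Set X), ∀ y ∈ hilbertLens C ψ v w ρ,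
      hilbertDist C (f z) (f y) ≤ hilbertDist C z y)
    {b c : ℝ} (hb : 0 < b) (hfv : f v = b • v) (hc : 0 < c) (hfw : f w = c • w) :
    Set.MapsTo (normalizedMap ψ f) (hilbertLens C ψ v w ρ) (hilbertLens C ψ v w ρ) := by
  have ha := lowerRatio_pos hψ hv.1 hw.1
  have hab := ha.trans_le (lowerRatio_le_upperRatio hψ hv.1)
  intro y hy
  exact ⟨⟨inv_apply_smul_mem_slice hψ (hf hy),
    normalizedMap_mem_ratioBall hψ hv.1 hy.1.1.1 (hf hy) hρ (hnonexp v (by simp) y hy) hb hfv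
      hy.1.2⟩,
    normalizedMap_mem_ratioBall hψ hw.1 hy.1.1.1 (hf hy) (by positivity)
      (hnonexp w (by simp) y hy) hc hfw hy.2⟩

end HilbertLens

section AlmostFixedPoint

variable {E : Type*} [NormedAddCommGroup E] [NormedSpace ℝ E]

theorem birkhoffAverage_mem_of_convex {α : Type*} {s : Set E} (hs : Convex ℝ s) {g : α → α}
    {φ : α → E} {x : α} (hφ : ∀ k, φ (g^[k] x) ∈ s) {n : ℕ} (hn : n ≠ 0) :
    birkhoffAverage ℝ g φ n x ∈ s := by
  rw [birkhoffAverage, birkhoffSum, Finset.smul_sum]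
  refine hs.sum_mem (fun _ _ => by positivity) ?_ fun k _ => hφ k
  rw [Finset.sum_const, Finset.card_range, nsmul_eq_mul, mul_inv_cancel₀ (Nat.cast_ne_zero.2 hn)]

/-- Averages along an orbit are almost fixed by the affine map, because the displacements
`y - g y` telescope. -/
theorem exists_mem_norm_apply_sub_le_of_mapsTo {B : Set E} (hB : Convex ℝ B) (hBne : B.Nonempty)
    (hBbdd : Bornology.IsBounded B) {g : E → E} (hg : Set.MapsTo g B B) (D : E →+ E) (v : E)
    {η ε : ℝ} (hε : 0 < ε) (hη : ∀ y ∈ B, ‖D (y - v) - (y - g y)‖ ≤ η) :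
    ∃ y ∈ B, ‖D (y - v)‖ ≤ η + ε := by
  obtain ⟨x, hx⟩ := hBne
  have horbit (k : ℕ) : g^[k] x ∈ B := hg.iterate k hx
  have hlim := tendsto_birkhoffAverage_apply_sub_birkhoffAverage ℝ (f := g) (g := id) (x := x)
    (hBbdd.subset (Set.range_subset_iff.2 horbit))
  obtain ⟨n, hn0, hn⟩ := ((eventually_ne_atTop 0).and
    (hlim.norm.eventually_le_const (by simpa using hε))).exists
  refine ⟨birkhoffAverage ℝ g id n x, birkhoffAverage_mem_of_convex hB horbit hn0, ?_⟩
  have herror : birkhoffAverage ℝ g (fun y => D (y - v) - (y - g y)) n x ∈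
      Metric.closedBall (0 : E) η :=
    birkhoffAverage_mem_of_convex (convex_closedBall 0 η)
      (fun k => mem_closedBall_zero_iff.2 (hη _ (horbit k))) hn0
  have hconst : birkhoffAverage ℝ g (fun _ => v) n = fun _ => v :=
    birkhoffAverage_of_comp_eq ℝ rfl (Nat.cast_ne_zero.2 hn0)
  have hshift : birkhoffAverage ℝ g id n (g x) = birkhoffAverage ℝ g g n x := by
    simp only [birkhoffAverage, birkhoffSum, id, ← Function.iterate_succ_apply,
      ← Function.iterate_succ_apply']
  have hsplit : D (birkhoffAverage ℝ g id n x - v) =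
      birkhoffAverage ℝ g (fun y => D (y - v) - (y - g y)) n x -
        (birkhoffAverage ℝ g id n (g x) - birkhoffAverage ℝ g id n x) := by
    change _ = birkhoffAverage ℝ g ((D ∘ (id - fun _ => v)) - (id - g)) n x - _
    simp only [birkhoffAverage_sub, Pi.sub_apply, ← map_birkhoffAverage ℝ ℝ D, hconst, hshift]
    abel
  rw [hsplit]
  exact (norm_sub_le _ _).trans (add_le_add (mem_closedBall_zero_iff.1 herror) hn)

theorem eventually_exists_norm_sub_lt_of_mapsTo {g : E → E} {T : E →L[ℝ] E} {v : E}
    (hgT : HasFDerivAt g T v) (hgv : g v = v) {K α β : ℝ} (hK : 0 < K) (hα : 0 < α) (hβ : 0 < β) :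
    ∀ᶠ s in 𝓝[>] (0 : ℝ), ∀ B : Set E, Convex ℝ B → B.Nonempty → Set.MapsTo g B B →
      (∀ y ∈ B, ‖y - v‖ ≤ β * s) → (∀ y ∈ B, ‖y - v‖ ≤ K * ‖(y - v) - T (y - v)‖) →
      ∃ y ∈ B, ‖y - v‖ < α * s := by
  set η : ℝ := α / (4 * K * β)
  have hηpos : 0 < η := by positivity
  have hlin : ∀ᶠ y in 𝓝 v, ‖g y - v - T (y - v)‖ ≤ η * ‖y - v‖ := by
    simpa only [hgv] using (hasFDerivAt_iff_isLittleO.1 hgT).def hηpos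
  obtain ⟨δ, hδ, hball⟩ := Metric.eventually_nhds_iff.1 hlin
  filter_upwards [Ioo_mem_nhdsGT (show 0 < δ / β by positivity)] with s ⟨hs, hsδ⟩ B hB hBne hg
    hsmall hbelow
  have hηs (y : E) (hy : y ∈ B) :
      ‖AddMonoidHomClass.toAddMonoidHom (1 - T) (y - v) - (y - g y)‖ ≤ η * (β * s) := by
    have hyδ : dist y v < δ := by
      rw [dist_eq_norm]
      exact (hsmall y hy).trans_lt ((lt_div_iff₀' hβ).1 hsδ)
    calc _ = ‖g y - v - T (y - v)‖ := by congr 1; simp; abel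
      _ ≤ η * ‖y - v‖ := hball hyδ
      _ ≤ η * (β * s) := by gcongr; exact hsmall y hy
  have hBbdd : Bornology.IsBounded B :=
    Metric.isBounded_closedBall.subset fun y hy => mem_closedBall_iff_norm.2 (hsmall y hy)
  obtain ⟨y, hy, hyD⟩ := exists_mem_norm_apply_sub_le_of_mapsTo hB hBne hBbdd hg _ v
    (show 0 < η * (β * s) by positivity) hηs
  refine ⟨y, hy, ?_⟩
  calc ‖y - v‖ ≤ K * ‖(y - v) - T (y - v)‖ := hbelow y hy
    _ ≤ K * (η * (β * s) + η * (β * s)) := by gcongr; simpa using hyD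
    _ = α * s / 2 := by simp only [η]; field_simp; norm_num
    _ < α * s := half_lt_self (by positivity)

end AlmostFixedPoint

section Derivative

variable {f : X → X} {L : X →L[ℝ] X} {v : X}

theorem hasFDerivAt_normalizedMap (hf : HasFDerivAt f L v) (hfv : f v = v) {ψ : X →L[ℝ] ℝ}
    (hψ : ψ v = 1) : HasFDerivAt (normalizedMap ψ f) (L - (ψ.comp L).smulRight v) v := by
  have hψf : HasFDerivAt (fun x => ψ (f x)) (ψ.comp L) v := ψ.hasFDerivAt.comp v hf
  have hinv := (hasDerivAt_inv (x := ψ (f v)) (by simp [hfv, hψ])).comp_hasFDerivAt v hψf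
  refine (hinv.smul hf).congr_fderiv ?_
  ext x
  simp [hfv, hψ, sub_eq_add_neg]

theorem le_of_eventually_smul_le (hf : HasFDerivAt f L v)
    (hsub : ∀ᶠ t in 𝓝[<] (1 : ℝ), Le C (t • f v) (f (t • v))) : Le C (L v) (f v) := by
  have hray : HasDerivAt (fun t : ℝ => f (t • v)) (L v) 1 := by
    have hline : HasDerivAt (fun t : ℝ => t • v) v 1 := by
      simpa using (hasDerivAt_id (1 : ℝ)).smul_const v
    exact HasFDerivAt.comp_hasDerivAt (1 : ℝ) (by simpa using hf) hline
  have hlim := (hasDerivAt_iff_tendsto_slope_left_right.1 hray).1.const_sub (f v)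
  refine C.isClosed.mem_of_tendsto hlim ?_
  filter_upwards [hsub, self_mem_nhdsWithin] with t ht (ht1 : t < 1)
  have ht0 : 1 - t ≠ 0 := (sub_pos.2 ht1).ne'
  have hquot := C.smul_mem ht (inv_nonneg.2 (sub_pos.2 ht1).le)
  have heq : f v - slope (fun t : ℝ => f (t • v)) 1 t = (1 - t)⁻¹ • (f (t • v) - t • f v) :=
    calc f v - slope (fun t : ℝ => f (t • v)) 1 t
        = (1 - t)⁻¹ • (1 - t) • f v - (1 - t)⁻¹ • (f v - f (t • v)) := by
          rw [inv_smul_smul₀ ht0, slope_comm, slope_def_module, one_smul]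
      _ = (1 - t)⁻¹ • (f (t • v) - t • f v) := by module
  exact heq ▸ hquot

end Derivative

section PositiveOperator

variable {L : X →L[ℝ] X} {v : X} {ψ : X →L[ℝ] ℝ}

/-- Comparison with `v`: applying `L / r` to `u ≤ b v` gives `u ≤ (b / r) v`. -/
theorem eigenvalue_le_one (hL : ∀ z ∈ C, L z ∈ C) (hψ : IsNonzeroDual C ψ)
    (hv : v ∈ interior (C : Set X)) (hLv : Le C (L v) v) {u : X} {r : ℝ} (hu : L u = r • u)
    (hψu : 0 < ψ u) : r ≤ 1 := by
  rcases le_or_gt r 0 with hr | hr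
  · exact hr.trans zero_le_one
  set b := upperRatio C u v
  have hb : 0 < b := upperRatio_pos hψ hv hψu
  have hru : Le C (r • u) (b • v) := by
    have h := (le_upperRatio_smul (y := u) hψ hv).map hL
    rw [hu, map_smul] at h
    exact h.trans (hLv.smul hb.le)
  have hle : b ≤ r⁻¹ * b := by
    rw [upperRatio_le_iff hψ hv, mul_smul]
    exact (smul_le_iff_le_inv_smul hr).1 hru
  have h1 : 1 ≤ r⁻¹ := le_of_mul_le_mul_right (by rwa [one_mul]) hb
  exact (one_le_inv₀ hr).1 h1

/-- If `c > 0` and `m v ≤ h` with `m ≤ 0`, then `h = L h + c v ≥ (m + c) v`, so no such `m`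
is maximal. -/
theorem nonpos_of_sub_apply_eq_smul (hL : ∀ z ∈ C, L z ∈ C) (hψ : IsNonzeroDual C ψ)
    (hv : v ∈ interior (C : Set X)) (hLv : Le C (L v) v) {h : X} (hh : ψ h = 0) {c : ℝ}
    (hc : h - L h = c • v) : c ≤ 0 := by
  set m := lowerRatio C h v
  have hmv : Le C (m • v) h := lowerRatio_smul_le hψ hv
  have hm : m ≤ 0 := by
    have hψm := hmv.apply hψ.2
    rw [map_smul, smul_eq_mul, hh] at hψm
    exact nonpos_of_mul_nonpos_left hψm (apply_pos_of_mem_interior hψ hv)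
  have hLh : Le C (m • v) (L h) := by
    have hmLv : Le C (m • v) (m • L v) :=
      le_of_sub_eq (hLv.smul (neg_nonneg.2 hm)) (by module)
    rw [← map_smul] at hmLv
    exact hmLv.trans (hmv.map hL)
  have himprove : Le C ((m + c) • v) h :=
    le_of_sub_eq hLh (by rw [add_smul, ← hc]; abel)
  have hmax : m + c ≤ m := (le_lowerRatio_iff hψ hv).2 himprove
  linarith

theorem eq_zero_of_sub_apply_eq_smul (hL : ∀ z ∈ C, L z ∈ C) (hψ : IsNonzeroDual C ψ)
    (hv : v ∈ interior (C : Set X)) (hLv : Le C (L v) v) {h : X} (hh : ψ h = 0) {c : ℝ}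
    (hc : h - L h = c • v) : c = 0 := by
  refine le_antisymm (nonpos_of_sub_apply_eq_smul hL hψ hv hLv hh hc) (neg_nonpos.1 ?_)
  refine nonpos_of_sub_apply_eq_smul hL hψ hv hLv (h := -h) (by simp [hh]) ?_
  rw [map_neg, neg_smul, ← hc]
  abel

theorem isUnit_one_sub_of_specRadius_lt_one [CompleteSpace X] (h : specRadius L < 1) :
    IsUnit (1 - L) := by
  obtain ⟨k, hk⟩ := exists_lt_of_ciInf_lt h
  have hpow : ‖L ^ (k + 1)‖ < 1 := by
    by_contra! hge
    exact hk.not_ge (Real.one_le_rpow hge (by positivity))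
  have hunit := isUnit_one_sub_of_norm_lt_one hpow
  rw [← mul_neg_geom_sum] at hunit
  have hcomm : Commute (1 - L) (∑ i ∈ Finset.range (k + 1), L ^ i) := by
    rw [Commute, SemiconjBy, geom_sum_mul_neg, mul_neg_geom_sum]
  exact (hcomm.isUnit_mul_iff.1 hunit).1

theorem isClosed_range_of_isUnit {S : X →L[ℝ] X} (hS : IsUnit S) : IsClosed (Set.range S) := by
  have hsurj : Function.Surjective S := (ContinuousLinearEquiv.unitsEquiv ℝ X hS.unit).surjective
  rw [hsurj.range_eq]
  exact isClosed_univ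

theorem specRadius_le_one (hWKR : WeakKreinRutman C L) (hψ : IsNonzeroDual C ψ)
    (hv : v ∈ interior (C : Set X)) (hLv : Le C (L v) v)
    (hpos : ∀ u ∈ C, u ≠ 0 → 0 < specRadius L → L u = specRadius L • u → 0 < ψ u) :
    specRadius L ≤ 1 := by
  obtain ⟨hL, hr | ⟨hr, ⟨u, huC, hu0, hker⟩, -⟩⟩ := hWKR
  · exact hr.le.trans zero_le_one
  · have hu : L u = specRadius L • u := by
      have hmem : u ∈ {x : X | (specRadius L • ContinuousLinearMap.id ℝ X - L) x = 0} :=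
        hker ▸ ⟨1, (one_smul ℝ u).symm⟩
      exact (sub_eq_zero.1 hmem).symm
    exact eigenvalue_le_one hL hψ hv hLv hu (hpos u huC hu0 hr hu)

theorem WeakKreinRutman.isClosed_range_one_sub [CompleteSpace X] (hWKR : WeakKreinRutman C L)
    (hr : specRadius L ≤ 1) : IsClosed (Set.range (1 - L : X →L[ℝ] X)) := by
  rcases hr.lt_or_eq with hlt | heq
  · exact isClosed_range_of_isUnit (isUnit_one_sub_of_specRadius_lt_one hlt)
  · obtain ⟨-, h0 | ⟨-, -, hclosed, -⟩⟩ := hWKR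
    · exact absurd (h0.symm.trans heq) zero_ne_one
    · rwa [heq, one_smul] at hclosed

theorem WeakKreinRutman.eq_zero_of_apply_eq_self [CompleteSpace X] (hWKR : WeakKreinRutman C L)
    (hr : specRadius L ≤ 1)
    (hpos : ∀ u ∈ C, u ≠ 0 → 0 < specRadius L → L u = specRadius L • u → 0 < ψ u)
    {h : X} (hLh : L h = h) (hψh : ψ h = 0) : h = 0 := by
  rcases hr.lt_or_eq with hlt | heq
  · have hunit := isUnit_one_sub_of_specRadius_lt_one hlt
    have hinj : Function.Injective (1 - L : X →L[ℝ] X) :=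
      (ContinuousLinearEquiv.unitsEquiv ℝ X hunit.unit).injective
    exact (map_eq_zero_iff _ hinj).1 (sub_eq_zero.2 hLh.symm)
  · obtain ⟨-, h0 | ⟨-, ⟨u, huC, hu0, hker⟩, -⟩⟩ := hWKR
    · exact absurd (h0.symm.trans heq) zero_ne_one
    · have hker' (x : X) : L x = x ↔ ∃ c : ℝ, x = c • u := by
        have hmem := Set.ext_iff.1 hker x
        rwa [heq, one_smul, Set.mem_ofPred_eq, sub_apply, ContinuousLinearMap.id_apply,
          sub_eq_zero, eq_comm] at hmem
      have hψu : 0 < ψ u := by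
        refine hpos u huC hu0 (heq ▸ one_pos) ?_
        rw [heq, one_smul, hker']
        exact ⟨1, (one_smul ℝ u).symm⟩
      obtain ⟨c, rfl⟩ := (hker' h).1 hLh
      rw [map_smul, smul_eq_mul, mul_eq_zero, or_iff_left hψu.ne'] at hψh
      rw [hψh, zero_smul]

end PositiveOperator

section BoundedBelow

variable {𝕜 E F : Type*} [NontriviallyNormedField 𝕜]
  [NormedAddCommGroup E] [NormedSpace 𝕜 E] [CompleteSpace E]
  [NormedAddCommGroup F] [NormedSpace 𝕜 F] [CompleteSpace F]

theorem isStrictMap_of_isClosed_range {S : E →L[𝕜] F} (hS : IsClosed (Set.range S)) :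
    IsStrictMap S := by
  have : CompleteSpace S.range := hS.completeSpace_coe
  have hsurj : Function.Surjective S.rangeRestrict := S.toLinearMap.surjective_rangeRestrict
  exact S.toLinearMap.isStrictMap_iff_isOpenQuotientMap_rangeRestrict.2
    ⟨hsurj, S.rangeRestrict.continuous, S.rangeRestrict.isOpenMap hsurj⟩

theorem exists_norm_le_of_hasFiniteRange_sub [CompleteSpace 𝕜] {S R : E →L[𝕜] F}
    (hS : IsClosed (Set.range S))
    (hSR : (S.toLinearMap - R.toLinearMap).HasFiniteRange) (A : Submodule 𝕜 E) [A.CoFG]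
    (hA : IsClosed (A : Set E)) (hinj : ∀ h ∈ A, R h = 0 → h = 0) :
    ∃ K > 0, ∀ h ∈ A, ‖h‖ ≤ K * ‖R h‖ := by
  have : CompleteSpace A := hA.completeSpace_coe
  have hR := (S.isStrictMap_isClosed_range_iff_of_finiteRangeSetoid R
    (LinearMap.FiniteRangeSetoid.equiv_iff_hasFiniteRange.2 hSR)).1
      ⟨isStrictMap_of_isClosed_range hS, hS⟩
  have hclosed := ((R.isStrictMap_isClosed_range_iff_restrict A hA).1 hR).2
  have hinjective : Function.Injective (R.domRestrict A) :=
    (injective_iff_map_eq_zero _).2 fun h hRh => Subtype.ext (hinj h h.2 hRh)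
  obtain ⟨K, hK⟩ :=
    (R.domRestrict A).antilipschitz_of_injective_of_isClosed_range hinjective hclosed
  refine ⟨K + 1, by positivity, fun h hh => ?_⟩
  calc ‖h‖ ≤ K * ‖R h‖ := (R.domRestrict A).bound_of_antilipschitz hK ⟨h, hh⟩
    _ ≤ (K + 1) * ‖R h‖ := by gcongr; linarith

theorem exists_norm_le_norm_sub_of_isClosed_range [CompleteSpace X] {L : X →L[ℝ] X} {v : X}
    {ψ : X →L[ℝ] ℝ} (hL : ∀ z ∈ C, L z ∈ C) (hψ : IsNonzeroDual C ψ)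
    (hv : v ∈ interior (C : Set X)) (hLv : Le C (L v) v)
    (hclosed : IsClosed (Set.range (1 - L : X →L[ℝ] X)))
    (hfix : ∀ h, L h = h → ψ h = 0 → h = 0) :
    ∃ K > 0, ∀ h, ψ h = 0 → ‖h‖ ≤ K * ‖h - (L - (ψ.comp L).smulRight v) h‖ := by
  set T := L - (ψ.comp L).smulRight v
  have : ψ.ker.CoFG := .ker _
  have hrank : ((1 - L : X →L[ℝ] X).toLinearMap - (1 - T).toLinearMap).HasFiniteRange := by
    have hdiff : (1 - L : X →L[ℝ] X).toLinearMap - (1 - T).toLinearMap =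
        -(LinearMap.toSpanSingleton ℝ X v ∘ₗ (ψ.comp L).toLinearMap) := by
      ext x
      simp [T]
    rw [hdiff]
    exact (LinearMap.HasFiniteRange.of_isNoetherian_rng.comp_left _).neg
  refine exists_norm_le_of_hasFiniteRange_sub hclosed hrank ψ.ker ψ.isClosed_ker
    fun h hψh hTh => ?_
  have hrange : h - L h = (-ψ (L h)) • v := by
    have : h - (L h - ψ (L h) • v) = 0 := hTh
    rw [neg_smul, eq_neg_iff_add_eq_zero, ← this]
    abel
  have hcoeff := eq_zero_of_sub_apply_eq_smul hL hψ hv hLv hψh hrange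
  rw [hcoeff, zero_smul, sub_eq_zero] at hrange
  exact hfix h hrange.symm hψh

end BoundedBelow

section Uniqueness

variable {ψ : X →L[ℝ] ℝ} {f : X → X} {v w : X}

theorem normalizedMap_eq_self (hv : ψ v = 1) {b : ℝ} (hb : b ≠ 0) (hfv : f v = b • v) :
    normalizedMap ψ f v = v := by
  rw [normalizedMap, hfv, map_smul, hv, smul_eq_mul, mul_one, inv_smul_smul₀ hb]

theorem eq_of_apply_eq_smul (hC : IsNormalCone C) (hψ : IsNonzeroDual C ψ) {G : Set X}
    (hG : G ∈ 𝓝 v) (hf : Set.MapsTo f (G ∩ slice C ψ) (interior (C : Set X)))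
    (hv : v ∈ slice C ψ) (hw : w ∈ slice C ψ)
    (hnonexp : ∀ z ∈ ({v, w} : Set X), ∀ y ∈ G ∩ slice C ψ,
      hilbertDist C (f z) (f y) ≤ hilbertDist C z y)
    {T : X →L[ℝ] X} (hT : HasFDerivAt (normalizedMap ψ f) T v) {K : ℝ} (hK : 0 < K)
    (hbelow : ∀ h, ψ h = 0 → ‖h‖ ≤ K * ‖h - T h‖)
    {b c : ℝ} (hb : 0 < b) (hfv : f v = b • v) (hc : 0 < c) (hfw : f w = c • w) : w = v := by
  by_contra hne
  have ha : 0 < lowerRatio C w v := lowerRatio_pos hψ hv.1 hw.1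
  have hab : lowerRatio C w v < upperRatio C w v :=
    lt_of_not_ge fun h => hne (eq_of_upperRatio_le_lowerRatio hC hψ hv hw h)
  obtain ⟨K₁, hK₁, hnear⟩ := exists_norm_sub_le_of_mem_ratioBall hC hψ hv
  obtain ⟨K₂, hK₂, hfar⟩ := exists_sub_one_le_of_mem_hilbertLens hψ hv hw
  obtain ⟨ε, hε, hball⟩ := Metric.mem_nhds_iff.1 hG
  have halmost := eventually_exists_norm_sub_lt_of_mapsTo hT
    (normalizedMap_eq_self hv.2 hb.ne' hfv) hK (show 0 < 1 / (3 * K₂) by positivity) hK₁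
  have hratio : 0 < upperRatio C w v / lowerRatio C w v - 1 :=
    sub_pos.2 ((one_lt_div ha).2 hab)
  have hsmall {δ : ℝ} (hδ : 0 < δ) : ∀ᶠ s in 𝓝[>] (0 : ℝ), s ∈ Set.Ioo 0 δ :=
    Ioo_mem_nhdsGT hδ
  obtain ⟨s, hs, ⟨hs0, hs1⟩, ⟨-, hsb⟩, -, hsε⟩ := (halmost.and ((hsmall one_pos).and
    ((hsmall hratio).and (hsmall (div_pos hε hK₁))))).exists
  have hnorm : ∀ y ∈ hilbertLens C ψ v w (1 + s), ‖y - v‖ ≤ K₁ * s := fun y hy => by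
    simpa only [add_sub_cancel_left] using hnear y _ hy.1.1.2 (by linarith) hy.1.2
  have hlens : hilbertLens C ψ v w (1 + s) ⊆ G ∩ slice C ψ := fun y hy =>
    ⟨hball (mem_ball_iff_norm.2 ((hnorm y hy).trans_lt ((lt_div_iff₀' hK₁).1 hsε))), hy.1.1⟩
  have hlensne : (hilbertLens C ψ v w (1 + s)).Nonempty :=
    hilbertLens_nonempty hψ hv hw (by linarith) ((lt_div_iff₀ ha).1 (by linarith))
  have hmaps := mapsTo_normalizedMap_hilbertLens hψ hv hw (by linarith) (hf.mono_left hlens)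
    (fun z hz y hy => hnonexp z hz y (hlens hy)) hb hfv hc hfw
  obtain ⟨y, hy, hlt⟩ := hs _ (convex_hilbertLens C ψ v w _) hlensne hmaps hnorm fun y hy =>
    hbelow _ (by rw [map_sub, hy.1.1.2, hv.2, sub_self])
  have hge : s ≤ K₂ * ‖y - v‖ * 3 :=
    calc s ≤ K₂ * ‖y - v‖ * (1 + s + 1) := by
          simpa only [add_sub_cancel_left] using hfar y (1 + s) (by linarith) hy
      _ ≤ K₂ * ‖y - v‖ * 3 := by gcongr; linarith
  rw [one_div_mul_eq_div, lt_div_iff₀ (by positivity)] at hlt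
  linarith

end Uniqueness

end ConeMap

open ConeMap in
theorem corollary8p3_general {X : Type*} [NormedAddCommGroup X] [NormedSpace ℝ X]
    [CompleteSpace X] {C : ProperCone ℝ X} (hC : IsNormalCone C) {ψ : X →L[ℝ] ℝ}
    (hψ : IsNonzeroDual C ψ) {G : Set X} {f : X → X} {v : X} (hG : G ∈ 𝓝 v)
    (hf : Set.MapsTo f (G ∩ slice C ψ) (interior (C : Set X)))
    (hnonexp : ∀ x ∈ G ∩ slice C ψ, ∀ y ∈ G ∩ slice C ψ,
      hilbertDist C (f x) (f y) ≤ hilbertDist C x y)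
    (hv : v ∈ slice C ψ) (hfv : f v = v) {L : X →L[ℝ] X} (hfL : HasFDerivAt f L v)
    (hL : ∀ x ∈ C, L x ∈ C) (hLv : Le C (L v) v)
    (hclosed : IsClosed (Set.range (1 - L : X →L[ℝ] X)))
    (hfix : ∀ h, L h = h → ψ h = 0 → h = 0) :
    ∀ w ∈ G ∩ slice C ψ, (∃ c : ℝ, 0 < c ∧ f w = c • w) ↔ w = v := by
  intro w hw
  have hfv' : f v = (1 : ℝ) • v := by rw [hfv, one_smul]
  constructor
  · rintro ⟨c, hc, hfw⟩
    obtain ⟨K, hK, hbelow⟩ :=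
      exists_norm_le_norm_sub_of_isClosed_range hL hψ hv.1 hLv hclosed hfix
    have hvw : {v, w} ⊆ G ∩ slice C ψ := Set.pair_subset ⟨mem_of_mem_nhds hG, hv⟩ hw
    exact eq_of_apply_eq_smul hC hψ hG hf hv hw.2 (fun z hz => hnonexp z (hvw hz))
      (hasFDerivAt_normalizedMap hfL hfv hv.2) hK hbelow one_pos hfv' hc hfw
  · rintro rfl
    exact ⟨1, one_pos, hfv'⟩

theorem corollary8p3 {X : Type*} [NormedAddCommGroup X] [NormedSpace ℝ X] [CompleteSpace X]
    (C : ProperCone ℝ X) (hC : ConeMap.IsNormalCone C)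
    (hCint : (interior (C : Set X)).Nonempty)
    (ψ : X →L[ℝ] ℝ) (hψ : ConeMap.IsNonzeroDual C ψ)
    (G : Set X) (hGopen : IsOpen G) (hGC : G ⊆ (C : Set X))
    (f : X → X) (hf : Set.MapsTo f G (interior (C : Set X)))
    (hnonexp : ∀ x ∈ G ∩ ConeMap.slice C ψ, ∀ y ∈ G ∩ ConeMap.slice C ψ,
      ConeMap.hilbertDist C (f x) (f y) ≤ ConeMap.hilbertDist C x y)
    (v : X) (hv : v ∈ G ∩ ConeMap.slice C ψ) (hfv : f v = v)
    (hdiff : DifferentiableAt ℝ f v)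
    (hWKR : ConeMap.WeakKreinRutman C (fderiv ℝ f v))
    (hpos : ∀ u ∈ C, u ≠ 0 → 0 < ConeMap.specRadius (fderiv ℝ f v) →
      fderiv ℝ f v u = ConeMap.specRadius (fderiv ℝ f v) • u → 0 < ψ u)
    (hsub : ∃ δ : ℝ, 0 < δ ∧ δ ≤ 1 ∧ ∀ t : ℝ, 1 - δ ≤ t → t ≤ 1 →
      t • v ∈ G ∧ ConeMap.Le C (t • f v) (f (t • v))) :
    ∀ w ∈ G ∩ ConeMap.slice C ψ, (∃ c : ℝ, 0 < c ∧ f w = c • w) ↔ w = v := by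
  obtain ⟨δ, hδ, -, hδsub⟩ := hsub
  have hLv : ConeMap.Le C (fderiv ℝ f v v) v := by
    have hsub' : ∀ᶠ t in 𝓝[<] (1 : ℝ), ConeMap.Le C (t • f v) (f (t • v)) := by
      filter_upwards [Ioo_mem_nhdsLT (sub_lt_self 1 hδ)] with t ht
      exact (hδsub t ht.1.le ht.2.le).2
    simpa only [hfv] using ConeMap.le_of_eventually_smul_le hdiff.hasFDerivAt hsub'
  have hr : ConeMap.specRadius (fderiv ℝ f v) ≤ 1 :=
    ConeMap.specRadius_le_one hWKR hψ hv.2.1 hLv hpos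
  exact corollary8p3_general hC hψ (hGopen.mem_nhds hv.1) (hf.mono_left Set.inter_subset_left)
    hnonexp hv.2 hfv hdiff.hasFDerivAt hWKR.1 hLv (hWKR.isClosed_range_one_sub hr)
    fun _ => hWKR.eq_zero_of_apply_eq_self hr hpos
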